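/- A signed permutation of rank $n$ is a permutation $\pi$ of $\{\pm1,\dots,\pm n\}$ with $\pi(-i)=-\pi(i)$ for all $i$; it is identified with the word $\pi(0)\pi(1)\cdots\pi(n)$, where $\pi(0)=0$. It is called up if $\pi(1)>0$. A run of $\pi$ is a maximal consecutive subword of $\pi(0)\pi(1)\cdots\pi(n)$ that is increasing or decreasing (as a word of integers). For $n\ge 1$ let $T(n,k)$ be the number of up signed permutations of rank $n$ with exactly $k$ runs, and let $T_n(x)=\sum_{k=1}^n T(n,k)x^k$. For $k\ge 1$ put $$t_{2k-1}(x)=(1+x)(1-x^2)^{k-1},\qquad t_{2k}(x)=-(1-x^2)^k .$$ **Theorem.** For every $n\ge 1$, as an identity of rational functions in the indeterminate $x$, $T_n(x)=\det(h_{ij})_{1\le i,j\le n}$, where $(h_{ij})$ is the lower Hessenberg matrix (that is, $h_{ij}=0$ for $j>i+1$) with entries $$h_{ij}=\begin{cases}\dfrac{x}{1+x}\,t_i(x), & j=1,\\[2mm] \dbinom{i}{j-1}\,t_{i-j+1}(x), & 2\le j\le i,\\[2mm] -1, & j=i+1,\\ 0, & j>i+1.\end{cases}$$ -/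

import Mathlib

open Polynomial

namespace AltRunB

/-- The set `±[n] = {-n, …, -1, 1, …, n}`. -/
noncomputable abbrev letters (n : ℕ) : Finset ℤ := (Finset.Icc (-(n : ℤ)) n).erase 0

/-- Signed permutations of rank `n`: permutations `π` of `±[n]` with `π (-i) = -π i`. -/
abbrev SignedPerm (n : ℕ) : Type :=
  {π : Equiv.Perm (letters n) // ∀ i j : letters n, (j : ℤ) = -(i : ℤ) → (π j : ℤ) = -(π i : ℤ)}

/-- The word `π(0) π(1) ⋯ π(n)` of a signed permutation, where `π(0) = 0`
(the letters at positions beyond `n` are never used). -/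
noncomputable def word {n : ℕ} (π : SignedPerm n) (i : ℕ) : ℤ :=
  if h : (i : ℤ) ∈ letters n then (π.1 ⟨i, h⟩ : ℤ) else 0

/-- The consecutive subword `w(i) ⋯ w(j)` is increasing or decreasing. -/
abbrev IsMonotonic (w : ℕ → ℤ) (i j : ℕ) : Prop :=
  (∀ m ∈ Finset.Ico i j, w m < w (m + 1)) ∨ (∀ m ∈ Finset.Ico i j, w (m + 1) < w m)

/-- The subword `w(i) ⋯ w(j)` is a run of the word `w(0) ⋯ w(n)`: a maximal monotonic
consecutive subword. -/
abbrev IsRun (w : ℕ → ℤ) (n i j : ℕ) : Prop :=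
  i < j ∧ IsMonotonic w i j ∧
    ∀ i' ∈ Finset.Icc 0 i, ∀ j' ∈ Finset.Icc j n, IsMonotonic w i' j' → i' = i ∧ j' = j

/-- The number of runs of the word `w(0) ⋯ w(n)`. -/
def numRuns (w : ℕ → ℤ) (n : ℕ) : ℕ :=
  ((Finset.range (n + 1) ×ˢ Finset.range (n + 1)).filter fun p => IsRun w n p.1 p.2).card

/-- `T(n,k)`: the number of up signed permutations (those with `π(1) > 0`) of rank `n`
with exactly `k` runs. -/
noncomputable def upRunNumber (n k : ℕ) : ℕ :=
  (Finset.univ.filter fun π : SignedPerm n => 0 < word π 1 ∧ numRuns (word π) n = k).card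

/-- The type `B` alternating run polynomial `T_n(x) = ∑_{k=1}^n T(n,k) x^k`. -/
noncomputable def runPoly (n : ℕ) : ℤ[X] :=
  ∑ k ∈ Finset.Icc 1 n, C (upRunNumber n k : ℤ) * X ^ k

/-- `t_{2k-1}(x) = (1+x)(1-x²)^{k-1}` and `t_{2k}(x) = -(1-x²)^k`, for indices at least `1`. -/
def t {R : Type*} [CommRing R] (n : ℕ) (x : R) : R :=
  if Odd n then (1 + x) * (1 - x ^ 2) ^ ((n - 1) / 2) else -(1 - x ^ 2) ^ (n / 2)

/-- A square matrix is lower Hessenberg if its `(i,j)` entry vanishes whenever `j > i + 1`. -/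
def IsLowerHessenberg {R : Type*} [Zero R] {n : ℕ} (H : Matrix (Fin n) (Fin n) R) : Prop :=
  ∀ i j : Fin n, (i : ℕ) + 1 < (j : ℕ) → H i j = 0

/-- The `n × n` matrix with (rows and columns numbered from `1`) entries
`x / (1 + x) * t_i(x)` for `j = 1`, `binom(i, j-1) * t_{i-j+1}(x)` for `2 ≤ j ≤ i`, `-1` for
`j = i + 1`, and `0` for `j > i + 1`. Rows and columns are numbered from `0` in the code. -/
def hessMatrix {K : Type*} [Field K] (n : ℕ) (x : K) : Matrix (Fin n) (Fin n) K :=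
  Matrix.of fun i j =>
    if (j : ℕ) = 0 then x / (1 + x) * t ((i : ℕ) + 1) x
    else if (j : ℕ) ≤ (i : ℕ) then
      (Nat.choose ((i : ℕ) + 1) (j : ℕ) : K) * t ((i : ℕ) + 1 - (j : ℕ)) x
    else if (j : ℕ) = (i : ℕ) + 1 then -1
    else 0

end AltRunB

namespace AltRunB

/-! Let U(N,n) and D(N,n) be the sums of x^(runs of w(0)⋯w(n)) over the words w of rank N that begin
with an ascent, satisfy w(n) < ⋯ < w(N), and have an ascent, respectively a descent, as their n-th
step. Then T_n = U(n,n) + D(n,n), and a further step gives U(N,n+1) = U(N,n) + x D(N,n). For a step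
down, drop the comparison between w(n) and w(n+1) and subtract the words with w(n) < w(n+1). Without
that comparison the sorted tail is independent of the pattern of the first n steps, so by
`sum_increasing` the sum is binom(N,n) 2^(N-n) times a diagonal sum of rank n.

With s = 1 - x², this is a linear system in n with constant coefficients, solved by the coefficients
of cosh(√s z) and sinh(√s z)/√s. Evaluated at n = N it relates diagonal values only; in exponential
generating functions the double-angle formulas turn it into (x/(1+x) + ∑_{n≥1} T_n zⁿ/n!) (cosh(√s
z) - (1+x) sinh(√s z)/√s) = x/(1+x). Since -t_n is the n-th coefficient of the second factor for n ≥
1, comparing coefficients gives T_N = x/(1+x) t_N + ∑_{1≤j<N} binom(N,j) t_{N-j} T_j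
(`convolution_of_recurrence`). These are the row relations that make a Hessenberg determinant equal
to T_n (`det_hessenberg`). -/

/-! ### Signed permutations as words. -/

theorem mem_letters {n : ℕ} {a : ℤ} : a ∈ letters n ↔ a ≠ 0 ∧ a.natAbs ≤ n := by
  rw [Finset.mem_erase, Finset.mem_Icc]
  omega

/-- Words of signed permutations of rank `n`, characterized by their letters. -/
def IsWord (n : ℕ) (w : ℕ → ℤ) : Prop :=
  w 0 = 0 ∧ (∀ i, n < i → w i = 0) ∧ (∀ i, 1 ≤ i → i ≤ n → w i ≠ 0 ∧ (w i).natAbs ≤ n) ∧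
    ∀ i j, 1 ≤ i → i ≤ n → 1 ≤ j → j ≤ n → (w i).natAbs = (w j).natAbs → i = j

theorem word_of_mem {n : ℕ} (π : SignedPerm n) {i : ℕ} (h1 : 1 ≤ i) (h2 : i ≤ n) :
    ∃ h : (i : ℤ) ∈ letters n, word π i = (π.1 ⟨i, h⟩ : ℤ) := by
  have h : (i : ℤ) ∈ letters n := mem_letters.2 (by omega)
  exact ⟨h, dif_pos h⟩

theorem word_eq_zero {n : ℕ} (π : SignedPerm n) {i : ℕ} (h : i = 0 ∨ n < i) : word π i = 0 :=
  dif_neg fun h' => by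
    rw [mem_letters] at h'
    omega

theorem isWord_word {n : ℕ} (π : SignedPerm n) : IsWord n (word π) := by
  refine ⟨word_eq_zero π (Or.inl rfl), fun i hi => word_eq_zero π (Or.inr hi),
    fun i h1 h2 => ?_, fun i j h1 h2 h3 h4 hij => ?_⟩
  · obtain ⟨h, e⟩ := word_of_mem π h1 h2
    rw [e]
    exact mem_letters.1 (π.1 ⟨i, h⟩).2
  · obtain ⟨h, e⟩ := word_of_mem π h1 h2
    obtain ⟨h', e'⟩ := word_of_mem π h3 h4
    rw [e, e'] at hij
    rcases Int.natAbs_eq_natAbs_iff.1 hij with h5 | h5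
    · have := congrArg Subtype.val (π.1.injective (Subtype.ext h5))
      simpa using this
    · have h'' : -(j : ℤ) ∈ letters n := mem_letters.2 (by omega)
      rw [← π.2 ⟨j, h'⟩ ⟨-j, h''⟩ rfl] at h5
      have := congrArg Subtype.val (π.1.injective (Subtype.ext h5))
      simp only at this
      omega

theorem word_injective (n : ℕ) : Function.Injective (word : SignedPerm n → ℕ → ℤ) := by
  intro π π' h
  have pos : ∀ k : letters n, 0 < (k : ℤ) → (π.1 k : ℤ) = π'.1 k := by
    rintro ⟨k, hk⟩ hpos
    simp only at hpos
    lift k to ℕ using hpos.le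
    have := congrFun h k
    unfold word at this
    rwa [dif_pos hk, dif_pos hk] at this
  apply Subtype.ext
  apply Equiv.ext
  intro k
  apply Subtype.ext
  have hk := mem_letters.1 k.2
  rcases lt_or_gt_of_ne hk.1 with hneg | hpos
  · have h' : -(k : ℤ) ∈ letters n := mem_letters.2 (by omega)
    rw [π.2 ⟨-k, h'⟩ k (by simp), π'.2 ⟨-k, h'⟩ k (by simp), pos ⟨-k, h'⟩ (by simpa using hneg)]
  · exact pos k hpos

/-- Extend w to the negative letters by oddness. Distinct absolute values make the extension
injective, hence bijective on the finite set of letters. -/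
theorem IsWord.exists_word {n : ℕ} {w : ℕ → ℤ} (hw : IsWord n w) :
    ∃ π : SignedPerm n, word π = w := by
  obtain ⟨h0, hbig, hmem, hinj⟩ := hw
  have hval : ∀ k : letters n,
      (if 0 < (k : ℤ) then w (k : ℤ).natAbs else -w (k : ℤ).natAbs) ∈ letters n := by
    intro k
    have hk := mem_letters.1 k.2
    have := hmem (k : ℤ).natAbs (by omega) hk.2
    rw [mem_letters]
    split_ifs <;> omega
  have hF : Function.Injective fun k : letters n => (⟨_, hval k⟩ : letters n) := by
    intro k l hkl
    have hk := mem_letters.1 k.2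
    have hl := mem_letters.1 l.2
    have h1 := hmem (k : ℤ).natAbs (by omega) hk.2
    have h2 := hmem (l : ℤ).natAbs (by omega) hl.2
    have e : (if 0 < (k : ℤ) then w (k : ℤ).natAbs else -w (k : ℤ).natAbs) =
      if 0 < (l : ℤ) then w (l : ℤ).natAbs else -w (l : ℤ).natAbs := congrArg Subtype.val hkl
    have h3 := hinj (k : ℤ).natAbs (l : ℤ).natAbs (by omega) hk.2 (by omega) hl.2
      (by split_ifs at e <;> omega)
    apply Subtype.ext
    rw [h3] at e
    split_ifs at e <;> omega
  refine ⟨⟨Equiv.ofBijective _ (Finite.injective_iff_bijective.1 hF), ?_⟩, ?_⟩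
  · intro i j hij
    have hi := mem_letters.1 i.2
    simp only [Equiv.ofBijective_apply, hij, Int.natAbs_neg]
    split_ifs <;> omega
  · funext i
    by_cases hi : i = 0 ∨ n < i
    · rw [word_eq_zero _ hi]
      rcases hi with rfl | hi
      · exact h0.symm
      · exact (hbig i hi).symm
    · obtain ⟨h, e⟩ := word_of_mem (n := n) ⟨Equiv.ofBijective _
        (Finite.injective_iff_bijective.1 hF), by
          intro i j hij
          have hi := mem_letters.1 i.2
          simp only [Equiv.ofBijective_apply, hij, Int.natAbs_neg]
          split_ifs <;> omega⟩ (i := i) (by omega) (by omega)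
      rw [e]
      simp only [Equiv.ofBijective_apply, Int.natAbs_natCast]
      rw [if_pos (by omega)]

/-- The words of the signed permutations of rank `n`. -/
noncomputable def words (n : ℕ) : Finset (ℕ → ℤ) :=
  Finset.univ.map ⟨word, word_injective n⟩

theorem mem_words {n : ℕ} {w : ℕ → ℤ} : w ∈ words n ↔ IsWord n w := by
  rw [words, Finset.mem_map]
  constructor
  · rintro ⟨π, -, rfl⟩
    exact isWord_word π
  · intro h
    obtain ⟨π, hπ⟩ := h.exists_word
    exact ⟨π, Finset.mem_univ _, hπ⟩

theorem IsWord.ne_succ {n : ℕ} {w : ℕ → ℤ} (hw : IsWord n w) {i : ℕ} (hi : i < n) :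
    w i ≠ w (i + 1) := by
  obtain ⟨h0, hbig, hmem, hinj⟩ := hw
  intro h
  rcases Nat.eq_zero_or_pos i with rfl | hpos
  · have := hmem 1 le_rfl (by omega)
    simp_all
  · have := hinj i (i + 1) hpos (by omega) (by omega) (by omega) (by rw [h])
    omega

/-! ### Deleting the last letter. -/

/-- The order embedding that makes room for the letters `±j`. -/
def stretch (j i : ℤ) : ℤ := if i.natAbs < j.natAbs then i else if 0 < i then i + 1 else i - 1

/-- The inverse of `stretch j`. -/
def shrink (j i : ℤ) : ℤ := if i.natAbs < j.natAbs then i else if 0 < i then i - 1 else i + 1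

theorem stretch_lt_stretch {j a b : ℤ} : stretch j a < stretch j b ↔ a < b := by
  unfold stretch
  split_ifs <;> omega

theorem shrink_stretch (j i : ℤ) : shrink j (stretch j i) = i := by
  unfold stretch shrink
  split_ifs <;> omega

theorem stretch_shrink {j i : ℤ} (hj : j ≠ 0) (hij : i.natAbs ≠ j.natAbs) :
    stretch j (shrink j i) = i := by
  unfold stretch shrink
  split_ifs <;> omega

theorem isWord_insertLast {n : ℕ} {w : ℕ → ℤ} {j : ℤ} (hw : IsWord n w) (hj : j ∈ letters (n + 1)) :
    IsWord (n + 1) fun i => if i = n + 1 then j else stretch j (w i) := by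
  obtain ⟨h0, hbig, hmem, hinj⟩ := hw
  rw [mem_letters] at hj
  have hs0 : stretch j 0 = 0 := by
    unfold stretch
    split_ifs <;> omega
  have hne : ∀ i : ℤ, (stretch j i).natAbs ≠ j.natAbs := by
    intro i
    unfold stretch
    split_ifs <;> omega
  refine ⟨by simp [h0, hs0], fun i hi => ?_, fun i h1 h2 => ?_, fun i k h1 h2 h3 h4 h => ?_⟩
  · simp only
    rw [if_neg (by omega), hbig i (by omega), hs0]
  · simp only
    split_ifs with hi
    · exact hj
    · have := hmem i h1 (by omega)
      unfold stretch
      split_ifs <;> omega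
  · simp only at h
    split_ifs at h with hi hk hk
    · omega
    · exact absurd h.symm (hne _)
    · exact absurd h (hne _)
    · apply hinj i k h1 (by omega) h3 (by omega)
      have := hmem i h1 (by omega)
      have := hmem k h3 (by omega)
      unfold stretch at h
      split_ifs at h <;> omega

theorem isWord_removeLast {n : ℕ} {w : ℕ → ℤ} (hw : IsWord (n + 1) w) :
    IsWord n fun i => if i = n + 1 then 0 else shrink (w (n + 1)) (w i) := by
  obtain ⟨h0, hbig, hmem, hinj⟩ := hw
  have hj := hmem (n + 1) (by omega) le_rfl
  have hs0 : shrink (w (n + 1)) 0 = 0 := by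
    unfold shrink
    split_ifs <;> omega
  refine ⟨by simp [h0, hs0], fun i hi => ?_, fun i h1 h2 => ?_, fun i k h1 h2 h3 h4 h => ?_⟩
  · simp only
    split_ifs with h
    · rfl
    · rw [hbig i (by omega), hs0]
  · simp only
    rw [if_neg (by omega)]
    have := hmem i h1 (by omega)
    have h5 := mt (hinj i (n + 1) h1 (by omega) (by omega) le_rfl) (by omega)
    unfold shrink
    split_ifs <;> omega
  · simp only at h
    rw [if_neg (by omega), if_neg (by omega)] at h
    apply hinj i k h1 (by omega) h3 (by omega)
    have := hmem i h1 (by omega)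
    have := hmem k h3 (by omega)
    have h5 := mt (hinj i (n + 1) h1 (by omega) (by omega) le_rfl) (by omega)
    have h6 := mt (hinj k (n + 1) h3 (by omega) (by omega) le_rfl) (by omega)
    unfold shrink at h
    split_ifs at h <;> omega

theorem card_letters (n : ℕ) : (letters n).card = 2 * n := by
  rw [Finset.card_erase_of_mem (by simp), Int.card_Icc]
  omega

/-- A function of words that depends only on the directions of the first `n` steps. -/
def DependsOnSteps {R : Type*} (n : ℕ) (φ : (ℕ → ℤ) → R) : Prop :=
  ∀ w w' : ℕ → ℤ, (∀ i < n, (w i < w (i + 1) ↔ w' i < w' (i + 1))) → φ w = φ w'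

/-- Delete the last letter, one of 2(N+1), and close the gap it leaves among the absolute values.
The inverse `stretch` is strictly increasing, so the directions of the first N steps survive. -/
theorem sum_words_succ {R : Type*} [CommRing R] {n N : ℕ} (hnN : n ≤ N) {φ : (ℕ → ℤ) → R}
    (hφ : DependsOnSteps n φ) :
    ∑ w ∈ words (N + 1), φ w = (2 * (N + 1) : R) * ∑ w ∈ words N, φ w := by
  have h1 : ∑ w ∈ words (N + 1), φ w = ∑ p ∈ words N ×ˢ letters (N + 1), φ p.1 := by
    refine Finset.sum_nbij'
      (fun w => (fun i => if i = N + 1 then 0 else shrink (w (N + 1)) (w i), w (N + 1)))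
      (fun p i => if i = N + 1 then p.2 else stretch p.2 (p.1 i)) ?_ ?_ ?_ ?_ ?_
    · intro w hw
      rw [mem_words] at hw
      exact Finset.mem_product.2 ⟨mem_words.2 (isWord_removeLast hw),
        mem_letters.2 (hw.2.2.1 (N + 1) (by omega) le_rfl)⟩
    · intro p hp
      obtain ⟨h1, h2⟩ := Finset.mem_product.1 hp
      exact mem_words.2 (isWord_insertLast (mem_words.1 h1) h2)
    · intro w hw
      obtain ⟨h0, hbig, hmem, hinj⟩ := mem_words.1 hw
      funext i
      simp only
      split_ifs with hi
      · rw [hi]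
      · refine stretch_shrink (hmem (N + 1) (by omega) le_rfl).1 fun h => ?_
        have hlast := hmem (N + 1) (by omega) le_rfl
        rcases Nat.eq_zero_or_pos i with rfl | hpos
        · rw [h0] at h
          omega
        · rcases le_or_gt i (N + 1) with hle | hlt
          · exact hi (hinj i (N + 1) hpos hle (by omega) le_rfl h)
          · rw [hbig i hlt] at h
            omega
    · intro p hp
      obtain ⟨h1, h2⟩ := Finset.mem_product.1 hp
      refine Prod.ext ?_ (by simp)
      funext i
      simp only [if_true]
      split_ifs with hi
      · exact ((mem_words.1 h1).2.1 i (by omega)).symm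
      · exact shrink_stretch _ _
    · intro w hw
      obtain ⟨h0, hbig, hmem, hinj⟩ := mem_words.1 hw
      apply hφ
      intro i hi
      simp only
      rw [if_neg (by omega), if_neg (by omega)]
      have hlast := hmem (N + 1) (by omega) le_rfl
      have key : ∀ k ≤ N, stretch (w (N + 1)) (shrink (w (N + 1)) (w k)) = w k := by
        intro k hk
        refine stretch_shrink (hmem (N + 1) (by omega) le_rfl).1 fun h => ?_
        rcases Nat.eq_zero_or_pos k with rfl | hpos
        · rw [h0] at h
          omega
        · have := hinj k (N + 1) hpos (by omega) (by omega) le_rfl h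
          omega
      rw [← stretch_lt_stretch (j := w (N + 1)) (a := shrink _ _), key i (by omega),
        key (i + 1) (by omega)]
  rw [h1, Finset.sum_product]
  simp only [Finset.sum_const, card_letters, nsmul_eq_mul]
  rw [← Finset.mul_sum]
  push_cast
  ring

theorem sum_words_add {R : Type*} [CommRing R] (n m : ℕ) {φ : (ℕ → ℤ) → R}
    (hφ : DependsOnSteps n φ) :
    (n.factorial : R) * ∑ w ∈ words (n + m), φ w =
      2 ^ m * ((n + m).factorial : R) * ∑ w ∈ words n, φ w := by
  induction m with
  | zero => simp
  | succ m ih =>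
    rw [← add_assoc, sum_words_succ (Nat.le_add_right n m) hφ, Nat.factorial_succ]
    push_cast at ih ⊢
    linear_combination (2 * (n + m + 1) : R) * ih

/-! ### Sorting the tail of a word. -/

theorem isWord_comp {N : ℕ} {w : ℕ → ℤ} (hw : IsWord N w) (e : Equiv.Perm ℕ)
    (he : ∀ i, i = 0 ∨ N < i → e i = i) : IsWord N (w ∘ e) := by
  obtain ⟨h0, hbig, hmem, hinj⟩ := hw
  have hmaps : ∀ i, 1 ≤ i → i ≤ N → 1 ≤ e i ∧ e i ≤ N := by
    intro i h1 h2
    by_contra h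
    have := e.injective (he (e i) (by omega))
    omega
  refine ⟨by simp [he, h0], fun i hi => ?_, fun i h1 h2 => ?_, fun i j h1 h2 h3 h4 h => ?_⟩
  · rw [Function.comp_apply, he i (Or.inr hi), hbig i hi]
  · exact hmem _ (hmaps i h1 h2).1 (hmaps i h1 h2).2
  · exact e.injective (hinj _ _ (hmaps i h1 h2).1 (hmaps i h1 h2).2 (hmaps j h3 h4).1
      (hmaps j h3 h4).2 h)

/-- The subword `w(a) ⋯ w(b)` is increasing. -/
def IncreasingOn (w : ℕ → ℤ) (a b : ℕ) : Prop := ∀ i, a ≤ i → i < b → w i < w (i + 1)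

theorem IncreasingOn.lt {w : ℕ → ℤ} {a b : ℕ} (h : IncreasingOn w a b) {i j : ℕ} (hai : a ≤ i)
    (hij : i < j) (hjb : j ≤ b) : w i < w j := by
  induction j, hij using Nat.le_induction with
  | base => exact h i hai (by omega)
  | succ j hj ih => exact (ih (by omega)).trans (h j (by omega) (by omega))

open Classical in
/-- Every injective tuple is sorted by exactly one permutation. -/
theorem sum_perm_strictMono {R : Type*} [CommRing R] {m : ℕ} {f : Fin m → ℤ}
    (hf : Function.Injective f) (r : R) :
    (∑ τ : Equiv.Perm (Fin m), if StrictMono (f ∘ τ) then r else 0) = r := by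
  have hsort : StrictMono (f ∘ Tuple.sort f) :=
    (Tuple.monotone_sort f).strictMono_of_injective (hf.comp (Tuple.sort f).injective)
  rw [Finset.sum_eq_single (Tuple.sort f)]
  · rw [if_pos hsort]
  · intro τ _ hτ
    rw [if_neg]
    intro h
    apply hτ
    have := Tuple.unique_monotone h.monotone hsort.monotone
    exact Equiv.ext fun i => hf (congrFun this i)
  · simp

-- Permuting the positions n+1, …, n+m changes neither the set of words nor φ, which sees only
-- positions 0, …, n. Each word has exactly one rearrangement of its tail that is increasing.
open Classical in
theorem factorial_mul_sum_increasing {R : Type*} [CommRing R] (n m : ℕ) {φ : (ℕ → ℤ) → R}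
    (hφ : DependsOnSteps n φ) :
    (m.factorial : R) *
        ∑ w ∈ words (n + m), (if IncreasingOn w (n + 1) (n + m) then φ w else 0) =
      ∑ w ∈ words (n + m), φ w := by
  set ι : Fin m ↪ ℕ := ⟨fun k => n + 1 + k, fun a b h => Fin.ext (by simpa using h)⟩ with hι
  have ι_apply : ∀ k, ι k = n + 1 + k := fun _ => rfl
  have hfix : ∀ τ : Equiv.Perm (Fin m), ∀ i, i ≤ n ∨ n + m < i →
      τ.viaFintypeEmbedding ι i = i := by
    intro τ i hi
    apply Equiv.Perm.viaFintypeEmbedding_apply_notMem_range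
    rintro ⟨k, rfl⟩
    have := k.2
    rw [ι_apply] at hi
    omega
  have hfix' : ∀ τ : Equiv.Perm (Fin m), ∀ i, i ≤ n ∨ n + m < i →
      (τ.viaFintypeEmbedding ι).symm i = i := by
    intro τ i hi
    rw [Equiv.symm_apply_eq, hfix τ i hi]
  have hsorted : ∀ (τ : Equiv.Perm (Fin m)) (w : ℕ → ℤ),
      IncreasingOn (w ∘ τ.viaFintypeEmbedding ι) (n + 1) (n + m) ↔
        StrictMono ((w ∘ ι) ∘ τ) := by
    intro τ w
    have e : ∀ k : Fin m, ((w ∘ ι) ∘ τ) k = (w ∘ τ.viaFintypeEmbedding ι) (n + 1 + k) := by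
      intro k
      have := Equiv.Perm.viaFintypeEmbedding_apply_image τ ι k
      simp only [Function.comp_apply]
      rw [← this]
      rfl
    constructor
    · intro h k l hkl
      rw [e, e]
      have := l.2
      exact h.lt (by omega) (by simpa using hkl) (by omega)
    · intro h i h1 h2
      have := @h ⟨i - (n + 1), by omega⟩ ⟨i + 1 - (n + 1), by omega⟩
        (Fin.mk_lt_mk.2 (by omega))
      rw [e, e] at this
      simp only at this
      rwa [show n + 1 + (i - (n + 1)) = i by omega,
        show n + 1 + (i + 1 - (n + 1)) = i + 1 by omega] at this
  have hperm : ∀ τ : Equiv.Perm (Fin m),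
      ∑ w ∈ words (n + m), (if IncreasingOn w (n + 1) (n + m) then φ w else 0) =
        ∑ w ∈ words (n + m), if StrictMono ((w ∘ ι) ∘ τ) then φ w else 0 := by
    intro τ
    refine Finset.sum_nbij' (fun w => w ∘ (τ.viaFintypeEmbedding ι).symm)
      (fun w => w ∘ τ.viaFintypeEmbedding ι) ?_ ?_ ?_ ?_ ?_
    · intro w hw
      exact mem_words.2 (isWord_comp (mem_words.1 hw) _ fun i hi => hfix' τ i (by omega))
    · intro w hw
      exact mem_words.2 (isWord_comp (mem_words.1 hw) _ fun i hi => hfix τ i (by omega))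
    · intro w _
      funext i
      simp
    · intro w _
      funext i
      simp
    · intro w _
      have h1 : (w ∘ (τ.viaFintypeEmbedding ι).symm) ∘ τ.viaFintypeEmbedding ι = w := by
        funext i
        simp
      have h2 : φ (w ∘ (τ.viaFintypeEmbedding ι).symm) = φ w := by
        apply hφ
        intro i hi
        simp only [Function.comp_apply]
        rw [hfix' τ i (by omega), hfix' τ (i + 1) (by omega)]
      simp only [← hsorted, h1, h2]
  have hcard : (m.factorial : R) *
        ∑ w ∈ words (n + m), (if IncreasingOn w (n + 1) (n + m) then φ w else 0) =
      ∑ τ : Equiv.Perm (Fin m), ∑ w ∈ words (n + m),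
        if StrictMono ((w ∘ ι) ∘ τ) then φ w else 0 := by
    rw [Finset.sum_congr rfl fun τ _ => (hperm τ).symm, Finset.sum_const, Finset.card_univ,
      Fintype.card_perm, Fintype.card_fin, nsmul_eq_mul]
  rw [hcard, Finset.sum_comm]
  refine Finset.sum_congr rfl fun w hw => ?_
  apply sum_perm_strictMono
  intro k l hkl
  obtain ⟨h0, hbig, hmem, hinj⟩ := mem_words.1 hw
  have := k.2
  have := l.2
  have := ι_apply k
  have := ι_apply l
  exact ι.injective (hinj _ _ (by omega) (by omega) (by omega) (by omega)
    (congrArg Int.natAbs hkl))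

open Classical in
/-- Summing over words whose last `N - n` letters are sorted. -/
theorem sum_increasing {K : Type*} [Field K] [CharZero K] {n N : ℕ} (hnN : n ≤ N)
    {φ : (ℕ → ℤ) → K} (hφ : DependsOnSteps n φ) :
    ∑ w ∈ words N, (if IncreasingOn w (n + 1) N then φ w else 0) =
      N.choose n * 2 ^ (N - n) * ∑ w ∈ words n, φ w := by
  obtain ⟨m, rfl⟩ := Nat.exists_eq_add_of_le hnN
  have h1 := factorial_mul_sum_increasing n m hφ
  have h2 := sum_words_add n m hφ
  have h3 : ((n + m).choose n : K) * n.factorial * m.factorial = (n + m).factorial := by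
    have := Nat.choose_mul_factorial_mul_factorial hnN
    rw [Nat.add_sub_cancel_left] at this
    exact_mod_cast this
  have hn : (n.factorial : K) ≠ 0 := by exact_mod_cast n.factorial_ne_zero
  have hm : (m.factorial : K) ≠ 0 := by exact_mod_cast m.factorial_ne_zero
  apply mul_left_cancel₀ (mul_ne_zero hn hm)
  rw [mul_assoc, h1, h2, ← h3, Nat.add_sub_cancel_left]
  ring

/-! ### Runs and changes of direction. -/

/-- One plus the number of changes of direction in `w(0) ⋯ w(n)`. -/
noncomputable def runs (w : ℕ → ℤ) (n : ℕ) : ℕ :=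
  1 + ((Finset.Ico 1 n).filter fun i => ¬(w (i - 1) < w i ↔ w i < w (i + 1))).card

theorem IsMonotonic.step_iff {w : ℕ → ℤ} {i j a b : ℕ} (h : IsMonotonic w i j)
    (ha : a ∈ Finset.Ico i j) (hb : b ∈ Finset.Ico i j) :
    w a < w (a + 1) ↔ w b < w (b + 1) := by
  rcases h with h | h
  · exact iff_of_true (h a ha) (h b hb)
  · exact iff_of_false (h a ha).not_gt (h b hb).not_gt

/-- A word without equal neighbours has one run for each change of direction, and one more. -/
theorem numRuns_eq_runs {w : ℕ → ℤ} {n : ℕ} (hn : 1 ≤ n) (hw : ∀ i < n, w i ≠ w (i + 1)) :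
    numRuns w n = runs w n := by
  classical
  have h_step : ∀ i < n, IsMonotonic w i (i + 1) := by
    intro i hi
    rcases lt_or_gt_of_ne (hw i hi) with h | h
    · exact Or.inl fun m hm => by
        rw [Finset.mem_Ico] at hm
        rwa [show m = i by omega]
    · exact Or.inr fun m hm => by
        rw [Finset.mem_Ico] at hm
        rwa [show m = i by omega]
  have h_extend : ∀ i j, 1 ≤ i → i < j → j ≤ n → IsMonotonic w i j →
      (w (i - 1) < w i ↔ w i < w (i + 1)) → IsMonotonic w (i - 1) j := by
    intro i j hi hij hjn hmono h
    have hne := hw (i - 1) (by omega)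
    rw [Nat.sub_add_cancel hi] at hne
    rcases hmono with hm | hm
    · refine Or.inl fun m hmem => ?_
      rw [Finset.mem_Ico] at hmem
      by_cases e : m = i - 1
      · rw [e, Nat.sub_add_cancel hi]
        exact h.2 (hm i (Finset.mem_Ico.2 ⟨le_rfl, hij⟩))
      · exact hm m (Finset.mem_Ico.2 (by omega))
    · refine Or.inr fun m hmem => ?_
      rw [Finset.mem_Ico] at hmem
      by_cases e : m = i - 1
      · rw [e, Nat.sub_add_cancel hi]
        have := hm i (Finset.mem_Ico.2 ⟨le_rfl, hij⟩)
        have : ¬ w (i - 1) < w i := fun h' => (h.1 h').not_gt this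
        omega
      · exact hm m (Finset.mem_Ico.2 (by omega))
  set starts : Finset ℕ := insert 0
    ((Finset.Ico 1 n).filter fun i => ¬(w (i - 1) < w i ↔ w i < w (i + 1))) with h_starts
  have h_card : starts.card = runs w n := by
    rw [h_starts, Finset.card_insert_of_notMem (by simp), runs, add_comm]
  rw [← h_card, numRuns]
  -- A run is determined by its start, and the starts are 0 and the turning positions.
  apply Finset.card_nbij Prod.fst
  · rintro ⟨i, j⟩ hp
    obtain ⟨hmem, hij, hmono, hmax⟩ := Finset.mem_filter.1 hp
    simp only [Finset.mem_product, Finset.mem_range] at hmem hij hmono hmax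
    rcases Nat.eq_zero_or_pos i with rfl | hi
    · simp [h_starts]
    · simp only [h_starts, Finset.coe_insert, Set.mem_insert_iff, Finset.mem_coe,
        Finset.mem_filter, Finset.mem_Ico]
      refine Or.inr ⟨by omega, fun h => ?_⟩
      have := hmax (i - 1) (Finset.mem_Icc.2 (by omega)) j (Finset.mem_Icc.2 (by omega))
        (h_extend i j hi hij (by omega) hmono h)
      omega
  · rintro ⟨i, j⟩ hp ⟨i', j'⟩ hp' h
    obtain ⟨hmem, hij, hmono, hmax⟩ := Finset.mem_filter.1 hp
    obtain ⟨hmem', hij', hmono', hmax'⟩ := Finset.mem_filter.1 hp'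
    simp only [Finset.mem_product, Finset.mem_range] at *
    subst h
    rcases le_total j j' with hle | hle
    · rw [(hmax i (Finset.mem_Icc.2 (by omega)) j' (Finset.mem_Icc.2 (by omega)) hmono').2]
    · rw [(hmax' i (Finset.mem_Icc.2 (by omega)) j (Finset.mem_Icc.2 (by omega)) hmono).2]
  · intro i hi
    have hi' : i < n ∧ (1 ≤ i → ¬(w (i - 1) < w i ↔ w i < w (i + 1))) := by
      simp only [h_starts, Finset.coe_insert, Set.mem_insert_iff, Finset.mem_coe,
        Finset.mem_filter, Finset.mem_Ico] at hi
      rcases hi with rfl | ⟨h1, h2⟩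
      · exact ⟨by omega, fun h => by omega⟩
      · exact ⟨h1.2, fun _ => h2⟩
    obtain ⟨hin, hchange⟩ := hi'
    -- The longest monotonic subword from i is a run: a monotonic extension to the left would
    -- contradict the turn at i.
    set j := Nat.findGreatest (fun j => IsMonotonic w i j) n with hj
    have hj1 : i + 1 ≤ j := Nat.le_findGreatest (P := fun j => IsMonotonic w i j) (by omega)
      (h_step i hin)
    have hj2 : j ≤ n := Nat.findGreatest_le n
    have hj3 : IsMonotonic w i j :=
      Nat.findGreatest_spec (P := fun j => IsMonotonic w i j) (show i + 1 ≤ n by omega)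
        (h_step i hin)
    refine ⟨(i, j), ?_, rfl⟩
    refine Finset.mem_coe.2 (Finset.mem_filter.2 ⟨?_, by omega, hj3, ?_⟩)
    · simp only [Finset.mem_product, Finset.mem_range]
      omega
    · intro i' hi' j' hj' hmono
      simp only [Finset.mem_Icc] at hi' hj'
      have e : i' = i := by
        by_contra hne
        refine hchange (by omega) ?_
        have := hmono.step_iff (a := i - 1) (b := i) (Finset.mem_Ico.2 (by omega))
          (Finset.mem_Ico.2 (by omega))
        rwa [show i - 1 + 1 = i by omega] at this
      subst e
      refine ⟨rfl, le_antisymm ?_ hj'.1⟩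
      exact Nat.le_findGreatest (P := fun j => IsMonotonic w i' j) hj'.2 hmono

theorem runs_mem_Icc {n : ℕ} (hn : 1 ≤ n) (w : ℕ → ℤ) : runs w n ∈ Finset.Icc 1 n := by
  have := Finset.card_filter_le (Finset.Ico 1 n) fun i => ¬(w (i - 1) < w i ↔ w i < w (i + 1))
  rw [Nat.card_Ico] at this
  rw [Finset.mem_Icc, runs]
  omega

/-! ### Hyperbolic coefficients and exponential generating functions. -/

/-- The coefficients of `cosh (√s z)` as an exponential generating function. -/
def coshCoeff {K : Type*} [CommRing K] (s : K) (k : ℕ) : K := if Even k then s ^ (k / 2) else 0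

/-- The coefficients of `sinh (√s z) / √s` as an exponential generating function. -/
def sinhCoeff {K : Type*} [CommRing K] (s : K) (k : ℕ) : K := if Even k then 0 else s ^ (k / 2)

theorem coshCoeff_succ {K : Type*} [CommRing K] (s : K) (k : ℕ) :
    coshCoeff s (k + 1) = s * sinhCoeff s k := by
  unfold coshCoeff sinhCoeff
  rcases Nat.even_or_odd k with h | h
  · rw [if_neg (by simpa [Nat.even_add_one] using h), if_pos h, mul_zero]
  · have h' := Nat.not_even_iff_odd.2 h
    rw [if_pos (by simpa [Nat.even_add_one] using h), if_neg h', ← pow_succ']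
    congr 1
    obtain ⟨m, rfl⟩ := h
    omega

theorem sinhCoeff_succ {K : Type*} [CommRing K] (s : K) (k : ℕ) :
    sinhCoeff s (k + 1) = coshCoeff s k := by
  unfold coshCoeff sinhCoeff
  rcases Nat.even_or_odd k with h | h
  · rw [if_neg (by simpa [Nat.even_add_one] using h), if_pos h]
    congr 1
    obtain ⟨m, rfl⟩ := h
    omega
  · rw [if_pos (by simpa [Nat.even_add_one] using h), if_neg (Nat.not_even_iff_odd.2 h)]

theorem coshCoeff_zero {K : Type*} [CommRing K] (s : K) : coshCoeff s 0 = 1 := by simp [coshCoeff]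

theorem sinhCoeff_zero {K : Type*} [CommRing K] (s : K) : sinhCoeff s 0 = 0 := by simp [sinhCoeff]

/-- The exponential generating function of a sequence. -/
noncomputable def egf {K : Type*} [Field K] (a : ℕ → K) : PowerSeries K :=
  PowerSeries.mk fun n => a n / (n.factorial : K)

theorem coeff_egf {K : Type*} [Field K] (a : ℕ → K) (n : ℕ) :
    PowerSeries.coeff n (egf a) = a n / (n.factorial : K) := by
  simp [egf]

theorem constantCoeff_egf {K : Type*} [Field K] (a : ℕ → K) :
    PowerSeries.constantCoeff (egf a) = a 0 := by
  rw [← PowerSeries.coeff_zero_eq_constantCoeff_apply, coeff_egf]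
  simp

section
variable {K : Type*} [Field K]

theorem egf_ext [CharZero K] {a b : ℕ → K} : egf a = egf b ↔ ∀ n, a n = b n := by
  constructor
  · intro h n
    have := congrArg (PowerSeries.coeff n) h
    rw [coeff_egf, coeff_egf] at this
    exact (div_left_inj' (by exact_mod_cast n.factorial_ne_zero)).1 this
  · intro h
    rw [funext h]

theorem egf_mul [CharZero K] (a b : ℕ → K) :
    egf a * egf b =
      egf fun n => ∑ j ∈ Finset.range (n + 1), (n.choose j : K) * a j * b (n - j) := by
  ext n
  rw [PowerSeries.coeff_mul, coeff_egf, Finset.Nat.sum_antidiagonal_eq_sum_range_succ_mk,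
    Finset.sum_div]
  refine Finset.sum_congr rfl fun j hj => ?_
  have hj' : j ≤ n := Nat.lt_succ_iff.1 (Finset.mem_range.1 hj)
  have h1 : (j.factorial : K) ≠ 0 := by exact_mod_cast j.factorial_ne_zero
  have h2 : ((n - j).factorial : K) ≠ 0 := by exact_mod_cast (n - j).factorial_ne_zero
  have h3 : (n.factorial : K) ≠ 0 := by exact_mod_cast n.factorial_ne_zero
  have h4 : (n.choose j : K) * j.factorial * (n - j).factorial = n.factorial := by
    exact_mod_cast Nat.choose_mul_factorial_mul_factorial hj'
  rw [coeff_egf, coeff_egf, ← h4]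
  have h5 : (n.choose j : K) ≠ 0 := by
    exact_mod_cast (Nat.choose_pos hj').ne'
  field_simp

theorem derivative_egf [CharZero K] (a : ℕ → K) :
    PowerSeries.derivative K (egf a) = egf fun n => a (n + 1) := by
  ext n
  rw [PowerSeries.coeff_derivative, coeff_egf, coeff_egf, Nat.factorial_succ]
  have h3 : (n.factorial : K) ≠ 0 := by exact_mod_cast n.factorial_ne_zero
  have h4 : (n : K) + 1 ≠ 0 := by exact_mod_cast n.succ_ne_zero
  push_cast
  field_simp

theorem C_mul_egf (r : K) (a : ℕ → K) : PowerSeries.C r * egf a = egf fun n => r * a n := by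
  ext n
  rw [PowerSeries.coeff_C_mul, coeff_egf, coeff_egf, mul_div_assoc]

theorem egf_add (a b : ℕ → K) : egf a + egf b = egf fun n => a n + b n := by
  ext n
  rw [map_add, coeff_egf, coeff_egf, coeff_egf, add_div]

theorem egf_sub (a b : ℕ → K) : egf a - egf b = egf fun n => a n - b n := by
  ext n
  rw [map_sub, coeff_egf, coeff_egf, coeff_egf, sub_div]

theorem egf_delta (r : K) : egf (fun n => if n = 0 then r else 0) = PowerSeries.C r := by
  ext n
  rw [coeff_egf, PowerSeries.coeff_C]
  split_ifs with h
  · simp [h]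
  · simp

/-- Uniqueness for the system `f' = s r g`, `g' = r f`. -/
theorem eq_of_derivative_system [CharZero K] (r s : K) {f g f₁ g₁ : PowerSeries K}
    (hf : PowerSeries.derivative K f = PowerSeries.C (r * s) * g)
    (hg : PowerSeries.derivative K g = PowerSeries.C r * f)
    (hf₁ : PowerSeries.derivative K f₁ = PowerSeries.C (r * s) * g₁)
    (hg₁ : PowerSeries.derivative K g₁ = PowerSeries.C r * f₁)
    (h0 : PowerSeries.coeff 0 f = PowerSeries.coeff 0 f₁)
    (h0' : PowerSeries.coeff 0 g = PowerSeries.coeff 0 g₁) : f = f₁ ∧ g = g₁ := by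
  have key : ∀ n, PowerSeries.coeff n f = PowerSeries.coeff n f₁ ∧
      PowerSeries.coeff n g = PowerSeries.coeff n g₁ := by
    intro n
    induction n with
    | zero => exact ⟨h0, h0'⟩
    | succ n ih =>
      have h4 : (n : K) + 1 ≠ 0 := by exact_mod_cast n.succ_ne_zero
      have e1 := congrArg (PowerSeries.coeff n) hf
      have e2 := congrArg (PowerSeries.coeff n) hg
      have e3 := congrArg (PowerSeries.coeff n) hf₁
      have e4 := congrArg (PowerSeries.coeff n) hg₁
      rw [PowerSeries.coeff_derivative, PowerSeries.coeff_C_mul] at e1 e2 e3 e4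
      rw [ih.2, ← e3] at e1
      rw [ih.1, ← e4] at e2
      exact ⟨mul_right_cancel₀ h4 e1, mul_right_cancel₀ h4 e2⟩
  exact ⟨PowerSeries.ext fun n => (key n).1, PowerSeries.ext fun n => (key n).2⟩

/-- The derivative of the left side vanishes and its constant term is 1. Only s occurs, so no square
root of s is needed in K. -/
theorem cosh_sq_sub_sinh_sq [CharZero K] (s : K) :
    egf (coshCoeff s) ^ 2 - PowerSeries.C s * egf (sinhCoeff s) ^ 2 = 1 := by
  apply PowerSeries.derivative.ext
  · have h1 : PowerSeries.derivative K (egf (coshCoeff s)) =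
        PowerSeries.C s * egf (sinhCoeff s) := by
      rw [derivative_egf, C_mul_egf]
      exact egf_ext.2 fun n => coshCoeff_succ s n
    have h2 : PowerSeries.derivative K (egf (sinhCoeff s)) = egf (coshCoeff s) := by
      rw [derivative_egf]
      exact egf_ext.2 fun n => sinhCoeff_succ s n
    simp only [map_sub, Derivation.leibniz, sq, h1, h2, smul_eq_mul, PowerSeries.derivative_C,
      Derivation.map_one_eq_zero]
    ring
  · simp [constantCoeff_egf, coshCoeff_zero, sinhCoeff_zero]

/-- Both pairs solve f' = 2s g, g' = 2f with the same initial values. -/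
theorem cosh_sinh_double [CharZero K] (s : K) :
    egf (fun n => 2 ^ n * coshCoeff s n) =
        egf (coshCoeff s) ^ 2 + PowerSeries.C s * egf (sinhCoeff s) ^ 2 ∧
      egf (fun n => 2 ^ n * sinhCoeff s n) = 2 * egf (sinhCoeff s) * egf (coshCoeff s) := by
  have h1 : PowerSeries.derivative K (egf (coshCoeff s)) =
      PowerSeries.C s * egf (sinhCoeff s) := by
    rw [derivative_egf, C_mul_egf]
    exact egf_ext.2 fun n => coshCoeff_succ s n
  have h2 : PowerSeries.derivative K (egf (sinhCoeff s)) = egf (coshCoeff s) := by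
    rw [derivative_egf]
    exact egf_ext.2 fun n => sinhCoeff_succ s n
  have h3 : (2 : PowerSeries K) = PowerSeries.C 2 := (map_ofNat _ 2).symm
  apply eq_of_derivative_system 2 s
  · rw [derivative_egf, C_mul_egf]
    refine egf_ext.2 fun n => ?_
    rw [coshCoeff_succ]
    ring
  · rw [derivative_egf, C_mul_egf]
    refine egf_ext.2 fun n => ?_
    rw [sinhCoeff_succ]
    ring
  · simp only [map_add, Derivation.leibniz, sq, h1, h2, smul_eq_mul, PowerSeries.derivative_C,
      map_mul, ← h3]
    ring
  · rw [h3]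
    simp only [Derivation.leibniz, h1, h2, smul_eq_mul, PowerSeries.derivative_C]
    rw [← h3]
    ring
  · simp [constantCoeff_egf, coshCoeff_zero, sinhCoeff_zero]
  · simp [constantCoeff_egf, coshCoeff_zero, sinhCoeff_zero]

/-! ### From the triangular system to the convolution recurrence. -/

/-- Solution of the triangular system satisfied by the refined run polynomials. -/
theorem closed_form_of_recurrence (x : K) (y q : ℕ → K) (f : ℕ → K) (N : ℕ)
    (f_zero : f 0 = 0) (y_one : y 1 = x ^ 2) (q_one : q 1 = 0)
    (y_succ : ∀ n, 1 ≤ n → n < N → y (n + 1) = -(1 - x ^ 2) * q n + f n)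
    (q_succ : ∀ n, 1 ≤ n → n < N → q (n + 1) = f n - y n) (n : ℕ) (hn : 1 ≤ n) (hnN : n ≤ N) :
    y n = x ^ 2 * sinhCoeff (1 - x ^ 2) n + ∑ j ∈ Finset.range n, f j *
        (sinhCoeff (1 - x ^ 2) (n - j) - coshCoeff (1 - x ^ 2) (n - j)) ∧
      (1 - x ^ 2) * q n = -x ^ 2 * coshCoeff (1 - x ^ 2) n + ∑ j ∈ Finset.range n, f j *
        ((1 - x ^ 2) * sinhCoeff (1 - x ^ 2) (n - j) - coshCoeff (1 - x ^ 2) (n - j)) := by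
  induction n, hn using Nat.le_induction with
  | base =>
    simp [f_zero, y_one, q_one, sinhCoeff, coshCoeff]
  | succ n hn ih =>
    obtain ⟨ih1, ih2⟩ := ih (by omega)
    rw [y_succ n hn (by omega), q_succ n hn (by omega), Finset.sum_range_succ,
      Finset.sum_range_succ]
    have e1 : n + 1 - n = 1 := by omega
    have e2 : ∀ j ∈ Finset.range n, n + 1 - j = (n - j) + 1 := fun j hj => by
      have := Finset.mem_range.1 hj
      omega
    have e3 : sinhCoeff (1 - x ^ 2) 1 = 1 := by simp [sinhCoeff]
    have e4 : coshCoeff (1 - x ^ 2) 1 = 0 := by simp [coshCoeff]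
    -- Raising n by one exchanges the two sums up to a factor, because the shift exchanges the cosh
    -- and sinh coefficients.
    have s1 : ∑ j ∈ Finset.range n, f j *
          (sinhCoeff (1 - x ^ 2) (n + 1 - j) - coshCoeff (1 - x ^ 2) (n + 1 - j)) =
        - ∑ j ∈ Finset.range n, f j *
          ((1 - x ^ 2) * sinhCoeff (1 - x ^ 2) (n - j) - coshCoeff (1 - x ^ 2) (n - j)) := by
      rw [← Finset.sum_neg_distrib]
      refine Finset.sum_congr rfl fun j hj => ?_
      rw [e2 j hj, sinhCoeff_succ, coshCoeff_succ]
      ring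
    have s2 : ∑ j ∈ Finset.range n, f j * ((1 - x ^ 2) *
          sinhCoeff (1 - x ^ 2) (n + 1 - j) - coshCoeff (1 - x ^ 2) (n + 1 - j)) =
        - (1 - x ^ 2) * ∑ j ∈ Finset.range n, f j *
          (sinhCoeff (1 - x ^ 2) (n - j) - coshCoeff (1 - x ^ 2) (n - j)) := by
      rw [Finset.mul_sum]
      refine Finset.sum_congr rfl fun j hj => ?_
      rw [e2 j hj, sinhCoeff_succ, coshCoeff_succ]
      ring
    rw [s1, s2, e1, e3, e4, sinhCoeff_succ, coshCoeff_succ]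
    constructor
    · linear_combination -ih2
    · linear_combination -(1 - x ^ 2) * ih1

theorem t_eq (x : K) (n : ℕ) (hn : 1 ≤ n) :
    t n x = (1 + x) * sinhCoeff (1 - x ^ 2) n - coshCoeff (1 - x ^ 2) n := by
  unfold t sinhCoeff coshCoeff
  rcases Nat.even_or_odd n with h | h
  · rw [if_neg (Nat.not_odd_iff_even.2 h), if_pos h, if_pos h]
    ring
  · rw [if_pos h, if_neg (Nat.not_even_iff_odd.2 h), if_neg (Nat.not_even_iff_odd.2 h)]
    obtain ⟨m, rfl⟩ := h
    rw [show (2 * m + 1 - 1) / 2 = m by omega, show (2 * m + 1) / 2 = m by omega]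
    ring

/-- The convolution recurrence, from the triangular system for sums with a sorted tail. -/
theorem convolution_of_recurrence [CharZero K] (x : K) (hx : x ≠ 0) (hx1 : 1 + x ≠ 0)
    (hx2 : 1 - x ≠ 0)
    (U D : ℕ → ℕ → K)
    (U_one : ∀ N, 1 ≤ N → U N 1 = x) (D_one : ∀ N, 1 ≤ N → D N 1 = 0)
    (U_succ : ∀ N n, 1 ≤ n → n < N → U N (n + 1) = U N n + x * D N n)
    (D_succ : ∀ N n, 1 ≤ n → n < N → D N (n + 1) =
      x * (N.choose n * 2 ^ (N - n) * U n n - U N n) +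
        (N.choose n * 2 ^ (N - n) * D n n - D N n))
    (N : ℕ) (hN : 1 ≤ N) :
    U N N + D N N = x / (1 + x) * t N x +
      ∑ j ∈ Finset.Ico 1 N, (N.choose j : K) * t (N - j) x * (U j j + D j j) := by
  set s : K := 1 - x ^ 2 with hs_def
  have hs : s ≠ 0 := by
    have : s = (1 + x) * (1 - x) := by rw [hs_def]; ring
    rw [this]
    exact mul_ne_zero hx1 hx2
  set c : ℕ → K := fun n => if n = 0 then 0 else x * U n n + D n n with hc
  -- The values at 0 are not sums over words: degree 0 of `E2` forces s d(0) = -x², and then `E3`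
  -- forces T(0) = x/(1+x).
  set d : ℕ → K := fun n => if n = 0 then -x ^ 2 / s else D n n with hd
  set T : ℕ → K := fun n => if n = 0 then x / (1 + x) else U n n + D n n with hT
  have closed : ∀ n, 1 ≤ n →
      c n = x ^ 2 * sinhCoeff s n + ∑ j ∈ Finset.range n, (n.choose j * 2 ^ (n - j) * c j) *
        (sinhCoeff s (n - j) - coshCoeff s (n - j)) ∧
      s * d n = -x ^ 2 * coshCoeff s n + ∑ j ∈ Finset.range n, (n.choose j * 2 ^ (n - j) * c j) *
        (s * sinhCoeff s (n - j) - coshCoeff s (n - j)) := by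
    intro n hn
    have hn0 : n ≠ 0 := by omega
    -- The rank n stays fixed while k runs from 1 to n. The forcing terms involve only diagonal
    -- values of smaller rank, and k = n returns c(n) and d(n).
    have := closed_form_of_recurrence x (fun k => x * U n k + D n k) (fun k => D n k)
      (fun j => n.choose j * 2 ^ (n - j) * c j) n (by simp [hc])
      (by simp [U_one n hn, D_one n hn]; ring) (D_one n hn)
      (fun k hk hkn => by
        simp only [U_succ n k hk hkn, D_succ n k hk hkn, hc, if_neg (show k ≠ 0 by omega)]
        ring)
      (fun k hk hkn => by
        simp only [D_succ n k hk hkn, hc, if_neg (show k ≠ 0 by omega)]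
        ring) n hn le_rfl
    simpa only [hd, if_neg hn0, hc] using this
  have hc0 : c 0 = 0 := by simp [hc]
  have hd0 : s * d 0 = -x ^ 2 := by
    simp only [hd, if_true]
    field_simp
  have one_egf : (1 : PowerSeries K) = egf fun n => if n = 0 then 1 else 0 := by
    rw [egf_delta, map_one]
  -- The summand 1 cancels the constant term -1 of sinh - cosh, so the product has no term j = n,
  -- matching the sum over j < n.
  have E1 : egf c = PowerSeries.C (x ^ 2) * egf (sinhCoeff s) +
      egf c * (egf (fun n => 2 ^ n * sinhCoeff s n) - egf (fun n => 2 ^ n * coshCoeff s n) + 1) := by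
    rw [one_egf, egf_sub, egf_add, egf_mul, C_mul_egf, egf_add]
    refine egf_ext.2 fun n => ?_
    rw [Finset.sum_range_succ]
    rcases Nat.eq_zero_or_pos n with rfl | hn
    · simp [hc0, sinhCoeff_zero]
    · rw [(closed n hn).1]
      simp only [Nat.sub_self, sinhCoeff_zero, coshCoeff_zero, if_true, pow_zero]
      have : ∀ j ∈ Finset.range n, (n.choose j * 2 ^ (n - j) * c j) *
          (sinhCoeff s (n - j) - coshCoeff s (n - j)) = n.choose j * c j *
          (2 ^ (n - j) * sinhCoeff s (n - j) - 2 ^ (n - j) * coshCoeff s (n - j) +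
            if n - j = 0 then 1 else 0) := by
        intro j hj
        have := Finset.mem_range.1 hj
        rw [if_neg (by omega)]
        ring
      rw [Finset.sum_congr rfl this]
      ring
  have E2 : PowerSeries.C s * egf d = PowerSeries.C (-x ^ 2) * egf (coshCoeff s) +
      egf c * (PowerSeries.C s * egf (fun n => 2 ^ n * sinhCoeff s n) -
        egf (fun n => 2 ^ n * coshCoeff s n) + 1) := by
    rw [one_egf, C_mul_egf, C_mul_egf, C_mul_egf, egf_sub, egf_add, egf_mul, egf_add]
    refine egf_ext.2 fun n => ?_
    rw [Finset.sum_range_succ]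
    rcases Nat.eq_zero_or_pos n with rfl | hn
    · simp [hc0, hd0, coshCoeff_zero]
    · rw [(closed n hn).2]
      simp only [Nat.sub_self, sinhCoeff_zero, coshCoeff_zero, if_true, pow_zero]
      have : ∀ j ∈ Finset.range n, (n.choose j * 2 ^ (n - j) * c j) *
          (s * sinhCoeff s (n - j) - coshCoeff s (n - j)) = n.choose j * c j *
          (s * (2 ^ (n - j) * sinhCoeff s (n - j)) - 2 ^ (n - j) * coshCoeff s (n - j) +
            if n - j = 0 then 1 else 0) := by
        intro j hj
        have := Finset.mem_range.1 hj
        rw [if_neg (by omega)]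
        ring
      rw [Finset.sum_congr rfl this]
      ring
  have E3 : PowerSeries.C x * egf T = egf c - PowerSeries.C (1 - x) * egf d := by
    rw [C_mul_egf, C_mul_egf, egf_sub]
    refine egf_ext.2 fun n => ?_
    rcases Nat.eq_zero_or_pos n with rfl | hn
    · simp only [hT, hc, hd, if_true]
      rw [hs_def] at hs ⊢
      have : 1 - x ^ 2 = (1 + x) * (1 - x) := by ring
      rw [this]
      field_simp
      ring
    · simp only [hT, hc, hd, if_neg hn.ne']
      ring
  have hcs := cosh_sq_sub_sinh_sq s
  obtain ⟨hC2, hS2⟩ := cosh_sinh_double s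
  rw [hC2, hS2] at E1 E2
  have hsC : PowerSeries.C s = 1 - PowerSeries.C x ^ 2 := by
    rw [hs_def, map_sub, map_pow, map_one]
  have E4 : egf T * (egf (coshCoeff s) - PowerSeries.C (1 + x) * egf (sinhCoeff s)) =
      PowerSeries.C (x / (1 + x)) := by
    have hne : PowerSeries.C (s * x) ≠ 0 := by
      rw [Ne, map_eq_zero_iff _ PowerSeries.C_injective]
      exact mul_ne_zero hs hx
    have hr : PowerSeries.C (s * x) * PowerSeries.C (x / (1 + x)) =
        PowerSeries.C ((1 - x) * x ^ 2) := by
      rw [← map_mul]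
      congr 1
      rw [hs_def]
      field_simp
      ring
    apply mul_left_cancel₀ hne
    rw [hr]
    simp only [map_mul, map_sub, map_add, map_neg, map_pow, map_one] at E1 E2 E3 ⊢
    rw [hsC] at E1 E2 hcs ⊢
    generalize PowerSeries.C x = x at *
    generalize egf (coshCoeff s) = C at *
    generalize egf (sinhCoeff s) = S at *
    generalize egf T = T at *
    generalize egf c = c at *
    generalize egf d = d at *
    -- `E3` trades T for c and d, `E2` eliminates d, `E1` then removes c, and cosh² - s sinh² = 1
    -- settles the rest.
    linear_combination (1 - x ^ 2) * (C - (1 + x) * S) * E3 -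
      (1 - x) * (C - (1 + x) * S) * E2 + (1 - x ^ 2) * (C - (1 - x) * S) * E1 +
      (x ^ 2 * (1 - x) - (1 - x ^ 2) * c * (C - (1 + x) * S) +
        (1 - x) * c * (C - (1 + x) * S)) * hcs
  rw [C_mul_egf, egf_sub, egf_mul, ← egf_delta, egf_ext] at E4
  -- The term j = 0 yields x/(1+x) t_N, the term j = N yields T_N.
  have h := E4 N
  rw [if_neg (by omega), Finset.sum_range_succ, Finset.range_eq_Ico,
    Finset.sum_eq_sum_Ico_succ_bot (by omega)] at h
  have h5 : ∀ j ∈ Finset.Ico 1 N, (N.choose j : K) * T j *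
      (coshCoeff s (N - j) - (1 + x) * sinhCoeff s (N - j)) =
      - ((N.choose j : K) * t (N - j) x * (U j j + D j j)) := by
    intro j hj
    rw [Finset.mem_Ico] at hj
    rw [t_eq x _ (by omega), ← hs_def]
    simp only [hT, if_neg (show j ≠ 0 by omega)]
    ring
  rw [zero_add, Finset.sum_congr rfl h5, Finset.sum_neg_distrib] at h
  simp only [hT, if_true, if_neg (show N ≠ 0 by omega), Nat.sub_self, Nat.sub_zero,
    Nat.choose_zero_right, Nat.choose_self, sinhCoeff_zero, coshCoeff_zero, Nat.cast_one] at h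
  rw [t_eq x N hN, ← hs_def]
  linear_combination h

end

/-! ### Hessenberg determinants. -/

/-- A Hessenberg matrix with superdiagonal `-1` sends `(D 0, …, D (n-1))` to `(0, …, 0, D n)` when
`D` satisfies the recurrence given by its rows; its determinant is then `D n`. -/
theorem det_hessenberg {R : Type*} [CommRing R] (h : ℕ → ℕ → R) (D : ℕ → R) (n : ℕ)
    (h_super : ∀ i, h i (i + 1) = -1) (h_zero : ∀ i j, i + 1 < j → h i j = 0)
    (D_zero : D 0 = 1)
    (D_succ : ∀ i, i < n → D (i + 1) = ∑ j ∈ Finset.range (i + 1), h i j * D j) :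
    (Matrix.of fun i j : Fin n => h i j).det = D n := by
  rcases n with _ | n
  · simp [D_zero]
  set H : Matrix (Fin (n + 1)) (Fin (n + 1)) R := Matrix.of fun i j => h i j with hH
  -- Replacing column 0 by ∑ D(j) · column j multiplies the determinant by D(0) = 1. By the
  -- recurrence the -1 on the superdiagonal cancels every entry of the new column but the last.
  have h1 := Matrix.det_updateCol_sum H 0 (fun j => D j)
  have h2 : (fun k : Fin (n + 1) => ∑ i : Fin (n + 1), (fun j : Fin (n + 1) => D j) i • H k i) =
      fun k => if k = Fin.last n then D (n + 1) else 0 := by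
    funext k
    have h3 : ∑ i : Fin (n + 1), D i • H k i = ∑ j ∈ Finset.range (n + 1), h k j * D j := by
      rw [Finset.sum_range]
      exact Finset.sum_congr rfl fun i _ => by simp [hH, mul_comm]
    rw [h3]
    split_ifs with hk
    · subst hk
      exact (D_succ n (Nat.lt_succ_self n)).symm
    · have hkn : (k : ℕ) < n := by
        have := k.2
        have : (k : ℕ) ≠ n := fun h => hk (Fin.ext h)
        omega
      rw [← Finset.sum_subset (Finset.range_subset_range.2 (show (k : ℕ) + 2 ≤ n + 1 by omega)),
        Finset.sum_range_succ, h_super, ← D_succ k (by omega)]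
      · ring
      · intro j _ hj
        rw [h_zero _ _ (Nat.succ_le_iff.1 (Nat.succ_le_of_lt (by
          have := mt Finset.mem_range.2 hj
          omega))), zero_mul]
  rw [h2] at h1
  simp only [Fin.val_zero, D_zero, one_smul] at h1
  rw [← h1, Matrix.det_succ_column_zero, Finset.sum_eq_single (Fin.last n)]
  · have h4 : ((H.updateCol 0 fun k => if k = Fin.last n then D (n + 1) else 0).submatrix
        (Fin.last n).succAbove Fin.succ).det = (-1) ^ n := by
      rw [Matrix.det_of_isLowerTriangular]
      · simp [hH, h_super]
      · intro i j hij
        have hij' : (i : ℕ) < j := by simpa using hij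
        simpa [hH] using h_zero i (j + 1) (by omega)
    rw [h4]
    simp only [Matrix.updateCol_self, Fin.val_last, if_true]
    rw [mul_right_comm, ← mul_pow]
    simp
  · intro b _ hb
    simp [hb]
  · simp

/-! ### Run weights and their recurrences. -/

theorem runs_congr {w w' : ℕ → ℤ} {n : ℕ}
    (h : ∀ i < n, (w i < w (i + 1) ↔ w' i < w' (i + 1))) : runs w n = runs w' n := by
  unfold runs
  congr 2
  refine Finset.filter_congr fun i hi => ?_
  rw [Finset.mem_Ico] at hi
  have h1 := h (i - 1) (by omega)
  rw [Nat.sub_add_cancel hi.1] at h1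
  rw [h1, h i hi.2]

theorem runs_succ (w : ℕ → ℤ) {n : ℕ} (hn : 1 ≤ n) :
    runs w (n + 1) =
      runs w n + if (w (n - 1) < w n ↔ w n < w (n + 1)) then 0 else 1 := by
  unfold runs
  rw [← Finset.insert_Ico_right_eq_Ico_add_one hn, Finset.filter_insert]
  split_ifs with h1
  · rfl
  · rw [Finset.card_insert_of_notMem (by simp), add_assoc]

open Classical in
/-- The run weight of `w(0) ⋯ w(n)` if it begins and ends with an ascent, and `0` otherwise. -/
noncomputable def upWeight {K : Type*} [Field K] (x : K) (n : ℕ) (w : ℕ → ℤ) : K :=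
  if w 0 < w 1 ∧ w (n - 1) < w n then x ^ runs w n else 0

open Classical in
/-- The run weight of `w(0) ⋯ w(n)` if it begins with an ascent and does not end with one,
and `0` otherwise. -/
noncomputable def downWeight {K : Type*} [Field K] (x : K) (n : ℕ) (w : ℕ → ℤ) : K :=
  if w 0 < w 1 ∧ ¬ w (n - 1) < w n then x ^ runs w n else 0

theorem dependsOnSteps_upWeight {K : Type*} [Field K] (x : K) {n : ℕ} (hn : 1 ≤ n) :
    DependsOnSteps n (upWeight x n) := by
  intro w w' h
  have h1 := h (n - 1) (by omega)
  rw [Nat.sub_add_cancel hn] at h1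
  have h0 := h 0 hn
  rw [zero_add] at h0
  simp only [upWeight, runs_congr h, h1, h0]

theorem dependsOnSteps_downWeight {K : Type*} [Field K] (x : K) {n : ℕ} (hn : 1 ≤ n) :
    DependsOnSteps n (downWeight x n) := by
  intro w w' h
  have h1 := h (n - 1) (by omega)
  rw [Nat.sub_add_cancel hn] at h1
  have h0 := h 0 hn
  rw [zero_add] at h0
  simp only [downWeight, runs_congr h, h1, h0]

theorem upWeight_succ {K : Type*} [Field K] (x : K) {n : ℕ} (hn : 1 ≤ n) (w : ℕ → ℤ) :
    upWeight x (n + 1) w =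
      if w n < w (n + 1) then upWeight x n w + x * downWeight x n w else 0 := by
  unfold upWeight downWeight
  rw [runs_succ w hn, Nat.add_sub_cancel]
  by_cases h1 : w 0 < w 1 <;> by_cases h2 : w (n - 1) < w n <;>
    by_cases h3 : w n < w (n + 1) <;> simp [h1, h2, h3, pow_succ']

theorem downWeight_succ {K : Type*} [Field K] (x : K) {n : ℕ} (hn : 1 ≤ n) (w : ℕ → ℤ) :
    downWeight x (n + 1) w =
      if w n < w (n + 1) then 0 else x * upWeight x n w + downWeight x n w := by
  unfold upWeight downWeight
  rw [runs_succ w hn, Nat.add_sub_cancel]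
  by_cases h1 : w 0 < w 1 <;> by_cases h2 : w (n - 1) < w n <;>
    by_cases h3 : w n < w (n + 1) <;> simp [h1, h2, h3, pow_succ']

open Classical in
/-- The sum of a weight over the words of rank `N` with `w(n) < ⋯ < w(N)`. -/
noncomputable def tailSum {K : Type*} [Field K] (φ : (ℕ → ℤ) → K) (N n : ℕ) : K :=
  ∑ w ∈ words N, if IncreasingOn w n N then φ w else 0

theorem increasingOn_iff {w : ℕ → ℤ} {n N : ℕ} (h : n < N) :
    IncreasingOn w n N ↔ w n < w (n + 1) ∧ IncreasingOn w (n + 1) N := by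
  constructor
  · exact fun hw => ⟨hw n le_rfl h, fun i h1 h2 => hw i (by omega) h2⟩
  · rintro ⟨h1, h2⟩ i h3 h4
    rcases h3.eq_or_lt with rfl | h5
    · exact h1
    · exact h2 i h5 h4

theorem tailSum_self {K : Type*} [Field K] (φ : (ℕ → ℤ) → K) (N : ℕ) :
    tailSum φ N N = ∑ w ∈ words N, φ w :=
  Finset.sum_congr rfl fun _ _ => if_pos fun i h1 h2 => by omega

theorem tailSum_upWeight_succ {K : Type*} [Field K] (x : K) {N n : ℕ} (hn : 1 ≤ n) (hnN : n < N) :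
    tailSum (upWeight x (n + 1)) N (n + 1) =
      tailSum (upWeight x n) N n + x * tailSum (downWeight x n) N n := by
  unfold tailSum
  rw [Finset.mul_sum, ← Finset.sum_add_distrib]
  refine Finset.sum_congr rfl fun w _ => ?_
  have h := increasingOn_iff (w := w) hnN
  rw [upWeight_succ x hn]
  by_cases h1 : w n < w (n + 1) <;> by_cases h2 : IncreasingOn w (n + 1) N <;>
    simp [h, h1, h2]

/-- Words with w(n) > w(n+1) < ⋯ < w(N) are those with w(n+1) < ⋯ < w(N) minus those increasing
already from n. `sum_increasing` evaluates the former. -/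
theorem tailSum_downWeight_succ {K : Type*} [Field K] [CharZero K] (x : K) {N n : ℕ} (hn : 1 ≤ n)
    (hnN : n < N) :
    tailSum (downWeight x (n + 1)) N (n + 1) =
      x * (N.choose n * 2 ^ (N - n) * tailSum (upWeight x n) n n - tailSum (upWeight x n) N n) +
        (N.choose n * 2 ^ (N - n) * tailSum (downWeight x n) n n -
          tailSum (downWeight x n) N n) := by
  rw [tailSum_self, tailSum_self, ← sum_increasing hnN.le (dependsOnSteps_upWeight x hn),
    ← sum_increasing hnN.le (dependsOnSteps_downWeight x hn)]
  unfold tailSum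
  rw [← Finset.sum_sub_distrib, ← Finset.sum_sub_distrib, Finset.mul_sum,
    ← Finset.sum_add_distrib]
  refine Finset.sum_congr rfl fun w _ => ?_
  have h := increasingOn_iff (w := w) hnN
  rw [downWeight_succ x hn]
  by_cases h1 : w n < w (n + 1) <;> by_cases h2 : IncreasingOn w (n + 1) N <;>
    simp [h, h1, h2]

/-- The word of the identity, the only increasing word. -/
theorem IsWord.eq_of_increasing {N : ℕ} {w : ℕ → ℤ} (hw : IsWord N w) (h : IncreasingOn w 0 N) :
    w = fun i => if i ≤ N then (i : ℤ) else 0 := by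
  obtain ⟨h0, hbig, hmem, -⟩ := hw
  have h1 : ∀ i ≤ N, (i : ℤ) ≤ w i := by
    intro i
    induction i with
    | zero => simp [h0]
    | succ i ih =>
      intro hi
      have := ih (by omega)
      have := h i (by omega) hi
      push_cast
      omega
  -- Descending from w(N) ≤ N, each step back loses at least one; this meets the lower bound i ≤
  -- w(i).
  have h2 : ∀ k ≤ N, w (N - k) ≤ (N : ℤ) - k := by
    intro k
    induction k with
    | zero =>
      intro _
      rcases Nat.eq_zero_or_pos N with rfl | hN
      · simp [h0]
      · have := hmem N hN le_rfl
        simp only [Nat.sub_zero]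
        omega
    | succ k ih =>
      intro hk
      have h3 := ih (by omega)
      have h4 := h (N - (k + 1)) (by omega) (by omega)
      rw [show N - (k + 1) + 1 = N - k by omega] at h4
      push_cast
      omega
  funext i
  split_ifs with hi
  · have := h1 i hi
    have := h2 (N - i) (by omega)
    rw [show N - (N - i) = i by omega] at this
    omega
  · exact hbig i (by omega)

/-- An initial ascent together with w(1) < ⋯ < w(N) forces the identity, whose first step is a
single run. -/
theorem tailSum_upWeight_one {K : Type*} [Field K] (x : K) {N : ℕ} (hN : 1 ≤ N) :
    tailSum (upWeight x 1) N 1 = x := by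
  set v : ℕ → ℤ := fun i => if i ≤ N then (i : ℤ) else 0 with hv
  have hvi : ∀ i ≤ N, v i = i := fun i hi => if_pos hi
  have hvw : IsWord N v := by
    refine ⟨by simp [hv], fun i hi => if_neg (by omega), fun i h1 h2 => ?_,
      fun i j h1 h2 h3 h4 h => ?_⟩
    · rw [hvi i h2]
      omega
    · rw [hvi i h2, hvi j h4] at h
      simpa using h
  have h01 : v 0 < v 1 := by
    rw [hvi 0 (by omega), hvi 1 hN]
    norm_num
  unfold tailSum
  rw [Finset.sum_eq_single v]
  · rw [if_pos]
    · simp [upWeight, h01, runs]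
    · intro i h1 h2
      rw [hvi i (by omega), hvi (i + 1) (by omega)]
      push_cast
      omega
  · intro w hw hwv
    split_ifs with h
    · unfold upWeight
      rw [if_neg]
      intro h'
      exact hwv ((mem_words.1 hw).eq_of_increasing ((increasingOn_iff hN).2 ⟨h'.1, h⟩))
    · rfl
  · exact fun h => absurd (mem_words.2 hvw) h

theorem tailSum_downWeight_one {K : Type*} [Field K] (x : K) (N : ℕ) :
    tailSum (downWeight x 1) N 1 = 0 := by
  unfold tailSum
  refine Finset.sum_eq_zero fun w _ => ?_
  simp [downWeight]

/-! ### The run polynomial and the final assembly. -/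

open Classical in
/-- The run polynomial as a sum over words. -/
theorem aeval_runPoly {K : Type*} [Field K] [Algebra ℤ K] (x : K) {n : ℕ} (hn : 1 ≤ n) :
    aeval x (runPoly n) = tailSum (upWeight x n) n n + tailSum (downWeight x n) n n := by
  have h1 : tailSum (upWeight x n) n n + tailSum (downWeight x n) n n =
      ∑ π : SignedPerm n, if 0 < word π 1 then x ^ numRuns (word π) n else 0 := by
    rw [tailSum_self, tailSum_self, ← Finset.sum_add_distrib, words, Finset.sum_map]
    refine Finset.sum_congr rfl fun π _ => ?_
    rw [numRuns_eq_runs (w := word π) hn fun i hi => (isWord_word π).ne_succ hi]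
    have h0 : word π 0 = 0 := (isWord_word π).1
    simp only [Function.Embedding.coeFn_mk, upWeight, downWeight, h0]
    by_cases h2 : 0 < word π 1 <;> by_cases h3 : word π (n - 1) < word π n <;> simp [h2, h3]
  rw [h1, runPoly, map_sum, ← Finset.sum_filter,
    ← Finset.sum_fiberwise_of_maps_to (t := Finset.Icc 1 n)
      (g := fun π : SignedPerm n => numRuns (word π) n)]
  · refine Finset.sum_congr rfl fun k _ => ?_
    rw [Finset.filter_filter, Finset.sum_congr rfl (g := fun _ => x ^ k), Finset.sum_const,
      nsmul_eq_mul, upRunNumber]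
    · simp
    · intro π hπ
      rw [(Finset.mem_filter.1 hπ).2.2]
  · intro π _
    rw [numRuns_eq_runs (w := word π) hn fun i hi => (isWord_word π).ne_succ hi]
    exact runs_mem_Icc hn _

end AltRunB

/-- The identity is one of rational functions in an indeterminate `x` over `ℚ`. -/
theorem mainTheorem4 (n : ℕ) (hn : 1 ≤ n) :
    AltRunB.IsLowerHessenberg (AltRunB.hessMatrix n (RatFunc.X : RatFunc ℚ)) ∧
      Polynomial.aeval (RatFunc.X : RatFunc ℚ) (AltRunB.runPoly n) =
        (AltRunB.hessMatrix n (RatFunc.X : RatFunc ℚ)).det := by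
  constructor
  · intro i j hij
    simp only [AltRunB.hessMatrix, Matrix.of_apply]
    rw [if_neg (by omega), if_neg (by omega), if_neg (by omega)]
  set x : RatFunc ℚ := RatFunc.X with hx
  have hx0 : x ≠ 0 := RatFunc.X_ne_zero
  have hC : ∀ p : ℚ[X], p ≠ 0 → algebraMap ℚ[X] (RatFunc ℚ) p ≠ 0 := fun p hp =>
    RatFunc.algebraMap_ne_zero hp
  have hx1 : 1 + x ≠ 0 := by
    have := hC (1 + X) (by
      intro h
      simpa using congrArg (Polynomial.eval 0) h)
    simpa using this
  have hx2 : 1 - x ≠ 0 := by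
    have := hC (1 - X) (by
      intro h
      simpa using congrArg (Polynomial.eval 0) h)
    simpa using this
  set h : ℕ → ℕ → RatFunc ℚ := fun i j =>
    if j = 0 then x / (1 + x) * AltRunB.t (i + 1) x
    else if j ≤ i then (Nat.choose (i + 1) j : RatFunc ℚ) * AltRunB.t (i + 1 - j) x
    else if j = i + 1 then -1 else 0 with h_def
  -- `det_hessenberg` needs D(0) = 1, whereas the series has constant term x/(1+x); that factor sits
  -- in the first column of the matrix instead.
  set D : ℕ → RatFunc ℚ := fun i => if i = 0 then 1 else
    AltRunB.tailSum (AltRunB.upWeight x i) i i + AltRunB.tailSum (AltRunB.downWeight x i) i i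
    with D_def
  have key := AltRunB.det_hessenberg h D n
    (fun i => by simp [h_def])
    (fun i j hij => by
      simp only [h_def]
      rw [if_neg (by omega), if_neg (by omega), if_neg (by omega)])
    (by simp [D_def])
    (fun i _ => by
      have conv := AltRunB.convolution_of_recurrence x hx0 hx1 hx2
        (fun N n => AltRunB.tailSum (AltRunB.upWeight x n) N n)
        (fun N n => AltRunB.tailSum (AltRunB.downWeight x n) N n)
        (fun N hN => AltRunB.tailSum_upWeight_one x hN)
        (fun N _ => AltRunB.tailSum_downWeight_one x N)
        (fun N n => AltRunB.tailSum_upWeight_succ x)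
        (fun N n => AltRunB.tailSum_downWeight_succ x) (i + 1) (by omega)
      rw [Finset.range_eq_Ico, Finset.sum_eq_sum_Ico_succ_bot (by omega)]
      simp only [D_def, if_true, Nat.add_one_ne_zero, if_false, h_def, mul_one]
      rw [conv, zero_add]
      congr 1
      refine Finset.sum_congr rfl fun j hj => ?_
      rw [Finset.mem_Ico] at hj
      rw [if_neg (by omega), if_pos (by omega), if_neg (by omega)])
  rw [AltRunB.aeval_runPoly x hn]
  have e : AltRunB.hessMatrix n x = Matrix.of fun i j : Fin n => h i j := rfl
  rw [e, key]
  simp only [D_def]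
  rw [if_neg (by omega)]
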